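/- **Setting.** Let $\mathcal H=\{h_1,\dots,h_n\}$ be linear separators on $\mathbb R^d$, $h_i(x)=\langle w_i,x\rangle+b_i$ with $w_i\neq 0$, and let $h^*\in\mathcal H$ be a target such that no other $h\in\mathcal H$ satisfies $\operatorname{sgn}h(x)=\operatorname{sgn}h^*(x)$ for all $x\in\mathbb R^d$. Let $\mathcal X\subset\mathbb R^d$ be a finite set of examples and $p_0$ a probability distribution on $\mathcal H$ with $0<p_0(h^*)<1$. A *polytope* $\mathcal P$ is a nonempty set of the form $\{x:\operatorname{sgn}h(x)=\sigma_h\ \forall h\in\mathcal H\}$ with all $\sigma_h\in\{-1,1\}$; write $h(\mathcal P)=\sigma_h$. Two polytopes are *neighboring* if exactly one of the hyperplanes $\{h=0\}$ separates them. $\mathcal X$ is *$m$-rich* if every polytope contains at least $m$ examples of $\mathcal X$. When an example $x_t$ with label $y_t=\operatorname{sgn}h^*(x_t)$ is shown, put $\xi_t(h)=\operatorname{sgn}(h(x_t))\,y_t$. The learner's belief $P_t$ and the teacher's belief $P^{(t)}_t$ start at $P_0=P_0^{(t)}=p_0$ and are updated by $$P_{t+1}(h)=\tfrac1{N_t}P_t(h)\,w_l^{(1-\xi_t(h))/2},\qquad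 P^{(t)}_{t+1}(h)=\tfrac1{N'_t}P^{(t)}_t(h)\,w_o^{(1-\xi_t(h))/2},$$ where $N_t,N'_t$ are the normalization factors, $w_o<1$ is a constant, and $0<w_l\le w_o$, where $w_l$ may depend on the examples shown so far (including the current one) and on $h$. Fix $0<\epsilon<1$. The *Relaxed-Greedy Teaching Policy* does the following as long as $1-P^{(t)}_t(h^*)>\epsilon$ (otherwise it stops, and the beliefs no longer change). If there are neighboring polytopes $\mathcal P,\mathcal P'$ with $\sum_hP^{(t)}_t(h)h(\mathcal P)>0$ and $\sum_hP^{(t)}_t(h)h(\mathcal P')<0$, it takes such a pair and chooses $\mathcal P$ or $\mathcal P'$ by a fair coin; otherwise it takes a polytope that minimizes $|\sum_hP^{(t)}_t(h)h(\mathcal P)|$. Then $x_t$ is drawn uniformly at random from the examples of $\mathcal X$ in the chosen polytope, either with or without replacement. Which pair and which minimizer are used is an arbitrary function of the examples shown before. **Theorem.** If $\mathcal X$ is $m$-rich, then for each of these versions of the policy, in the first $m$ rounds it shows at most $m$ examples, and exactly $m$ unless it has stopped because $1-P^{(t)}(h^*)\le\epsilon$; the learner's belief $P_m$ after $m$ rounds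 satisfies $$\Pr\bigl(1-P_m(h^*)>\epsilon\bigr)<\frac{(1-\epsilon)(1-p_0(h^*))}{\epsilon\,p_0(h^*)}\,e^{-m(1-w_o)/4};$$ and consequently, for every $\delta>0$, if $$m\ \ge\ \frac4{1-w_o}\log\frac{(1-\epsilon)(1-p_0(h^*))}{\delta\,\epsilon\,p_0(h^*)},$$ then $\Pr(1-P_m(h^*)>\epsilon)<\delta$. -/

import Mathlib

noncomputable section

/-- A linear separator `x ↦ ⟪w, x⟫ + b` on `ℝ^d`, with `w ≠ 0`, so that its zero set is a
hyperplane. -/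
structure LinSep (d : ℕ) where
  w : EuclideanSpace ℝ (Fin d)
  b : ℝ
  w_ne_zero : w ≠ 0

namespace LinSep

variable {d n : ℕ}

/-- The value `h(x) = ⟪w, x⟫ + b`. -/
def eval (h : LinSep d) (x : EuclideanSpace ℝ (Fin d)) : ℝ := inner ℝ h.w x + h.b

/-- The label `sgn (h(x))`. -/
def label (h : LinSep d) (x : EuclideanSpace ℝ (Fin d)) : SignType := SignType.sign (h.eval x)

/-- The hyperplane `{x | h(x) = 0}`. -/
def hyperplane (h : LinSep d) : Set (EuclideanSpace ℝ (Fin d)) := {x | h.eval x = 0}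

end LinSep

namespace Teaching

open LinSep

variable {d n : ℕ}

/-- A polytope induced by `H`: a nonempty intersection of open half-spaces, one for every
hypothesis.  It is given by the labels `h(P) ∈ {-1, 1}` which the hypotheses take on it. -/
structure Polytope (H : Fin n → LinSep d) where
  sgn : Fin n → SignType
  sgn_ne_zero : ∀ i, sgn i ≠ 0
  exists_point : ∃ x, ∀ i, (H i).label x = sgn i

/-- The points of a polytope. -/
def Polytope.carrier {H : Fin n → LinSep d} (P : Polytope H) :
    Set (EuclideanSpace ℝ (Fin d)) := {x | ∀ i, (H i).label x = P.sgn i}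

open Classical in
/-- The examples of the teaching set `X` which lie in the polytope `P`. -/
def Polytope.examples {H : Fin n → LinSep d} (P : Polytope H)
    (X : Finset (EuclideanSpace ℝ (Fin d))) : Finset (EuclideanSpace ℝ (Fin d)) :=
  X.filter (fun x => x ∈ P.carrier)

/-- Two polytopes are neighboring if they are separated by exactly one of the hyperplanes
(several hypotheses may have this hyperplane as their boundary, e.g. `h` and `-h`). -/
def Neighboring {H : Fin n → LinSep d} (P P' : Polytope H) : Prop :=
  ∃ i, ∀ j, P.sgn j ≠ P'.sgn j ↔ (H j).hyperplane = (H i).hyperplane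

/-- `X` is `m`-rich: every induced polytope contains at least `m` examples. -/
def Rich (H : Fin n → LinSep d) (X : Finset (EuclideanSpace ℝ (Fin d))) (m : ℕ) : Prop :=
  ∀ P : Polytope H, m ≤ (P.examples X).card

/-- `ξ(h) = sgn (h(x)) * y`, where `y = sgn (h*(x))` is the true label of `x`. -/
def agreement (H : Fin n → LinSep d) (hs : Fin n) (x : EuclideanSpace ℝ (Fin d))
    (i : Fin n) : ℝ :=
  (((H i).label x * (H hs).label x : SignType) : ℝ)

/-- One belief update: `p(h)` is replaced by `p(h) * w(h) ^ ((1 - ξ(h)) / 2) / N`, with the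
normalization factor `N`. -/
def update (H : Fin n → LinSep d) (hs : Fin n) (w : Fin n → ℝ)
    (x : EuclideanSpace ℝ (Fin d)) (p : Fin n → ℝ) (i : Fin n) : ℝ :=
  p i * w i ^ ((1 - agreement H hs x i) / 2) /
    ∑ j, p j * w j ^ ((1 - agreement H hs x j) / 2)

/-- The learner's belief after the examples in the list (latest example first).  The factor by
which the learner decreases the weight of an inconsistent hypothesis at an update may depend on
all the examples shown so far (the current one being the head of the list), and on the
hypothesis. -/
def learnerPost (H : Fin n → LinSep d) (hs : Fin n) (p₀ : Fin n → ℝ)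
    (wl : List (EuclideanSpace ℝ (Fin d)) → Fin n → ℝ) :
    List (EuclideanSpace ℝ (Fin d)) → Fin n → ℝ
  | [] => p₀
  | x :: xs => update H hs (wl (x :: xs)) x (learnerPost H hs p₀ wl xs)

/-- The belief tracked by the teacher, who uses the constant factor `wo` (latest example
first). -/
def teacherPost (H : Fin n → LinSep d) (hs : Fin n) (p₀ : Fin n → ℝ) (wo : ℝ) :
    List (EuclideanSpace ℝ (Fin d)) → Fin n → ℝ
  | [] => p₀
  | x :: xs => update H hs (fun _ => wo) x (teacherPost H hs p₀ wo xs)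

/-- The weighted vote `∑ h, p(h) h(P)` of the hypotheses on a polytope. -/
def vote {H : Fin n → LinSep d} (p : Fin n → ℝ) (P : Polytope H) : ℝ :=
  ∑ i, p i * ((P.sgn i : SignType) : ℝ)

/-- `P` and `P'` are neighboring, with positive vote on `P` and negative vote on `P'`. -/
def Bipolar {H : Fin n → LinSep d} (p : Fin n → ℝ) (P P' : Polytope H) : Prop :=
  Neighboring P P' ∧ 0 < vote p P ∧ vote p P' < 0

/-- The choices that the policy leaves open: for every sequence of examples shown so far, which
bipolar pair of neighboring polytopes is used if there is one, and which minimizer of the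
absolute vote is used otherwise. -/
structure Choices (H : Fin n → LinSep d) (hs : Fin n) (p₀ : Fin n → ℝ) (wo : ℝ) where
  fst : List (EuclideanSpace ℝ (Fin d)) → Polytope H
  snd : List (EuclideanSpace ℝ (Fin d)) → Polytope H
  bipolar : ∀ xs, (∃ P P' : Polytope H, Bipolar (teacherPost H hs p₀ wo xs) P P') →
    Bipolar (teacherPost H hs p₀ wo xs) (fst xs) (snd xs)
  argmin : List (EuclideanSpace ℝ (Fin d)) → Polytope H
  argmin_le : ∀ xs (Q : Polytope H),
    |vote (teacherPost H hs p₀ wo xs) (argmin xs)| ≤ |vote (teacherPost H hs p₀ wo xs) Q|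

/-- Whether an example may be shown again. -/
inductive Sampling where
  | withReplacement
  | withoutReplacement

open Classical in
/-- The examples of `P` that can be shown after the examples `xs`. -/
def pool {H : Fin n → LinSep d} (X : Finset (EuclideanSpace ℝ (Fin d)))
    (xs : List (EuclideanSpace ℝ (Fin d))) (P : Polytope H) :
    Sampling → Finset (EuclideanSpace ℝ (Fin d))
  | .withReplacement => P.examples X
  | .withoutReplacement => (P.examples X).filter (fun x => x ∉ xs)

open Classical in
/-- Show an example drawn uniformly at random from the pool of `P` (if the pool is empty, no
example is shown). -/
def draw {H : Fin n → LinSep d} (X : Finset (EuclideanSpace ℝ (Fin d))) (S : Sampling)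
    (xs : List (EuclideanSpace ℝ (Fin d))) (P : Polytope H) :
    PMF (List (EuclideanSpace ℝ (Fin d))) :=
  if h : (pool X xs P S).Nonempty then
    (PMF.uniformOfFinset (pool X xs P S) h).map (fun x => x :: xs)
  else PMF.pure xs

open Classical in
/-- One round of the relaxed-greedy teaching policy: the law of the list of shown examples after
the round, given the list `xs` before the round.  The policy has stopped if the teacher's belief
in `h*` is at least `1 - ε`.  Otherwise, if there is a bipolar pair, a fair coin decides from
which of the two polytopes the example is drawn; if there is none, it is drawn from a polytope
that minimizes the absolute vote. -/
def step (H : Fin n → LinSep d) (hs : Fin n) (p₀ : Fin n → ℝ) (wo ε : ℝ)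
    (X : Finset (EuclideanSpace ℝ (Fin d))) (S : Sampling) (c : Choices H hs p₀ wo)
    (xs : List (EuclideanSpace ℝ (Fin d))) : PMF (List (EuclideanSpace ℝ (Fin d))) :=
  if ε < 1 - teacherPost H hs p₀ wo xs hs then
    if ∃ P P' : Polytope H, Bipolar (teacherPost H hs p₀ wo xs) P P' then
      (PMF.uniformOfFintype Bool).bind
        (fun coin => draw X S xs (if coin then c.fst xs else c.snd xs))
    else draw X S xs (c.argmin xs)
  else PMF.pure xs

/-- The law of the list of examples (latest first) shown by the policy in the first `m`
rounds. -/
def run (H : Fin n → LinSep d) (hs : Fin n) (p₀ : Fin n → ℝ) (wo ε : ℝ)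
    (X : Finset (EuclideanSpace ℝ (Fin d))) (S : Sampling) (c : Choices H hs p₀ wo) :
    ℕ → PMF (List (EuclideanSpace ℝ (Fin d)))
  | 0 => PMF.pure []
  | m + 1 => (run H hs p₀ wo ε X S c m).bind (step H hs p₀ wo ε X S c)

/-- The probability that the learner's belief in `h*` after `m` rounds satisfies
`1 - p(h*) > ε`. -/
def failureProb (H : Fin n → LinSep d) (hs : Fin n) (p₀ : Fin n → ℝ) (wo ε : ℝ)
    (X : Finset (EuclideanSpace ℝ (Fin d))) (S : Sampling) (c : Choices H hs p₀ wo)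
    (wl : List (EuclideanSpace ℝ (Fin d)) → Fin n → ℝ) (m : ℕ) : ℝ :=
  ((run H hs p₀ wo ε X S c m).toOuterMeasure
    {xs | 1 - learnerPost H hs p₀ wl xs hs > ε}).toReal

end Teaching

end

/-! The teacher's odds against the target, `1 / p(h*) - 1`, are a potential that shrinks in
expectation. Let the error mass `D` of a polytope be the weight of the hypotheses that disagree with
the target there. An example from it multiplies `1 / p(h*)` by `1 - (1 - wo) D`, so expected error
mass at least `(1 - p(h*)) / 4` shrinks the odds by the factor `1 - (1 - wo) / 4`. For a bipolar
pair the two error masses add up to at least `(1 - p(h*)) / 2` (`Bipolar.one_sub_le_errorMass_add`),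
and the coin averages them. If there is no such pair, some polytope has vote zero
(`exists_bipolar_or_vote_eq_zero`): votes at the two ends of a generic line are opposite, and
consecutive polytopes along it are neighbors. Vote zero means error mass `1/2`. Iterating, Markov's
inequality and `1 - x ≤ exp (-x)` give the bound. It transfers to the learner, who trusts the target
at least as much as the teacher believes (`teacherPost_le_learnerPost`). -/

namespace LinSep

variable {d n : ℕ}

/-! ### Separators along lines and generic points -/

lemma eval_add_smul (h : LinSep d) (x v : EuclideanSpace ℝ (Fin d)) (t : ℝ) :
    h.eval (x + t • v) = h.eval x + t * inner ℝ h.w v := by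
  simp only [eval, inner_add_right, inner_smul_right]; ring

/-- Two separators with the same hyperplane are proportional. -/
lemma exists_eval_eq_mul {g h : LinSep d} (hgh : g.hyperplane = h.hyperplane) :
    ∃ c : ℝ, ∀ x, g.eval x = c * h.eval x := by
  have hw : inner ℝ h.w h.w ≠ (0 : ℝ) := inner_self_ne_zero.2 h.w_ne_zero
  refine ⟨inner ℝ g.w h.w / inner ℝ h.w h.w, fun x => ?_⟩
  -- The foot of the perpendicular from `x` to the hyperplane of `h`.
  have hx : x + (-(h.eval x / inner ℝ h.w h.w)) • h.w ∈ h.hyperplane := by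
    change h.eval _ = 0
    rw [eval_add_smul]; field_simp; ring
  rw [← hgh] at hx
  change g.eval _ = 0 at hx
  rw [eval_add_smul] at hx
  have : g.eval x = h.eval x / inner ℝ h.w h.w * inner ℝ g.w h.w := by linarith
  rw [this]; ring

lemma hyperplane_eq_of_eval_eq_mul {g h : LinSep d} {c : ℝ} (hc : c ≠ 0)
    (hgh : ∀ x, g.eval x = c * h.eval x) : g.hyperplane = h.hyperplane := by
  ext x
  simp [hyperplane, hgh, hc]

end LinSep

/-- Finitely many functions that are affine on lines, none of them identically zero, have a common
point where none of them vanishes. -/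
lemma exists_forall_ne_zero_of_affine {E ι : Type*} [AddCommGroup E] [Module ℝ E]
    (f : ι → E → ℝ)
    (hf : ∀ i x y (t : ℝ), f i (x + t • (y - x)) = f i x + t * (f i y - f i x))
    (s : Finset ι) (hs : ∀ i ∈ s, ∃ x, f i x ≠ 0) : ∃ x, ∀ i ∈ s, f i x ≠ 0 := by
  classical
  induction s using Finset.induction_on with
  | empty => exact ⟨0, by simp⟩
  | insert a s _ ih =>
    obtain ⟨x, hx⟩ := ih fun i hi => hs i (Finset.mem_insert_of_mem hi)
    obtain ⟨y, hy⟩ := hs a (Finset.mem_insert_self a s)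
    -- On the line through `x` and `y` each function is nonzero somewhere, so it excludes at most
    -- one parameter.
    obtain ⟨t, ht⟩ := Infinite.exists_notMem_finset
      ((insert a s).image fun i => - f i x / (f i y - f i x))
    refine ⟨x + t • (y - x), fun i hi h0 => ht (Finset.mem_image.2 ⟨i, hi, ?_⟩)⟩
    rw [hf] at h0
    have hne : f i y - f i x ≠ 0 := by
      intro h
      rw [h, mul_zero, add_zero] at h0
      rcases Finset.mem_insert.1 hi with rfl | hi
      · exact hy (by linarith)
      · exact hx i hi h0
    field_simp
    linarith

/-! ### Bipolar pairs along a generic line -/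

namespace Teaching

open LinSep

variable {d n : ℕ}

/-- The polytope of a point which lies on none of the hyperplanes. -/
noncomputable def Polytope.ofPoint (H : Fin n → LinSep d) (x : EuclideanSpace ℝ (Fin d))
    (hx : ∀ i, (H i).eval x ≠ 0) : Polytope H where
  sgn i := (H i).label x
  sgn_ne_zero i := by simpa [LinSep.label] using hx i
  exists_point := ⟨x, fun _ => rfl⟩

/-- A generic line crosses different hyperplanes at different points. -/
lemma exists_generic_line (H : Fin n → LinSep d) :
    ∃ (x : ℝ → EuclideanSpace ℝ (Fin d)) (β τ : Fin n → ℝ), (∀ i, β i ≠ 0) ∧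
      (∀ i t, (H i).eval (x t) = β i * (t - τ i)) ∧
      ∀ i j, τ i = τ j ↔ (H i).hyperplane = (H j).hyperplane := by
  classical
  -- A direction parallel to none of the hyperplanes.
  obtain ⟨v, hv⟩ := exists_forall_ne_zero_of_affine
    (fun (i : Fin n) (x : EuclideanSpace ℝ (Fin d)) => (inner ℝ (H i).w x : ℝ))
    (fun i x y t => by simp only [inner_add_right, inner_smul_right, inner_sub_right])
    Finset.univ (fun i _ => ⟨(H i).w, inner_self_ne_zero.2 (H i).w_ne_zero⟩)
  replace hv := fun i => hv i (Finset.mem_univ i)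
  set β : Fin n → ℝ := fun i => inner ℝ (H i).w v with hβ
  -- A base point for which distinct hyperplanes are not crossed simultaneously; the function
  -- vanishes exactly when the crossing parameters of the pair coincide.
  obtain ⟨x₀, hx₀⟩ := exists_forall_ne_zero_of_affine
    (fun (p : Fin n × Fin n) (x : EuclideanSpace ℝ (Fin d)) =>
      (H p.1).eval x * β p.2 - (H p.2).eval x * β p.1)
    (fun p x y t => by
      simp only [LinSep.eval, inner_add_right, inner_smul_right, inner_sub_right]; ring)
    (Finset.univ.filter fun p => (H p.1).hyperplane ≠ (H p.2).hyperplane)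
    (fun p hp => by
      by_contra! hcon
      refine (Finset.mem_filter.1 hp).2
        (hyperplane_eq_of_eval_eq_mul (c := β p.1 / β p.2) (div_ne_zero (hv _) (hv _)) ?_)
      intro x
      have h1 := hcon x
      have h2 : β p.2 ≠ 0 := hv p.2
      field_simp
      linarith)
  have heval : ∀ i t, (H i).eval (x₀ + t • v) = β i * (t - -(H i).eval x₀ / β i) := by
    intro i t
    have h2 : β i ≠ 0 := hv i
    rw [eval_add_smul]
    field_simp
    simp only [hβ]; ring
  refine ⟨fun t => x₀ + t • v, β, fun i => -(H i).eval x₀ / β i, hv, heval, fun i j => ⟨?_, ?_⟩⟩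
  · intro h
    by_contra hne
    refine hx₀ (i, j) (Finset.mem_filter.2 ⟨Finset.mem_univ _, hne⟩) ?_
    have h1 : β i ≠ 0 := hv i
    have h2 : β j ≠ 0 := hv j
    simp only at h ⊢
    field_simp at h
    linarith
  · intro h
    have hi : x₀ + (-(H i).eval x₀ / β i) • v ∈ (H i).hyperplane := by
      change (H i).eval _ = 0
      rw [heval]; simp
    rw [h] at hi
    change (H j).eval _ = 0 at hi
    rw [heval] at hi
    have := (mul_eq_zero.1 hi).resolve_left (hv j)
    linarith

lemma sign_mul_sub_ne_iff {b s t τ : ℝ} (hb : b ≠ 0) (hs : s ≠ τ) (ht : t ≠ τ) :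
    SignType.sign (b * (s - τ)) ≠ SignType.sign (b * (t - τ)) ↔
      (s < τ ∧ τ < t) ∨ (t < τ ∧ τ < s) := by
  rw [sign_mul, sign_mul]
  rcases lt_or_gt_of_ne hs with h1 | h1 <;> rcases lt_or_gt_of_ne ht with h2 | h2
  · simp [sign_neg (sub_neg.2 h1), sign_neg (sub_neg.2 h2), h1.not_gt, h2.not_gt]
  · simp [sign_neg (sub_neg.2 h1), sign_pos (sub_pos.2 h2), h1, h2]
    exact hb
  · simp [sign_pos (sub_pos.2 h1), sign_neg (sub_neg.2 h2), h1, h2]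
    exact hb
  · simp [sign_pos (sub_pos.2 h1), sign_pos (sub_pos.2 h2), h1.not_gt, h2.not_gt]

/-- Whatever the weights, there is a bipolar pair of neighboring polytopes or a polytope with
vote zero. -/
theorem exists_bipolar_or_vote_eq_zero (H : Fin n → LinSep d) (p : Fin n → ℝ) :
    (∃ P P' : Polytope H, Bipolar p P P') ∨ ∃ Q : Polytope H, vote p Q = 0 := by
  classical
  obtain ⟨x, β, τ, hβ, hx, hτ⟩ := exists_generic_line H
  refine or_iff_not_imp_right.2 fun hzero => ?_
  push Not at hzero
  have hne : ∀ t, (∀ i, t ≠ τ i) → ∀ i, (H i).eval (x t) ≠ 0 := fun t ht i => by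
    rw [hx]; exact mul_ne_zero (hβ i) (sub_ne_zero.2 (ht i))
  let Q : ∀ t, (∀ i, t ≠ τ i) → Polytope H := fun t ht => Polytope.ofPoint H (x t) (hne t ht)
  have hQ : ∀ s t (hs : ∀ i, s ≠ τ i) (ht : ∀ i, t ≠ τ i) i,
      (Q s hs).sgn i ≠ (Q t ht).sgn i ↔ (s < τ i ∧ τ i < t) ∨ (t < τ i ∧ τ i < s) := by
    intro s t hs ht i
    rw [← sign_mul_sub_ne_iff (hβ i) (hs i) (ht i), ← hx, ← hx]
    rfl
  -- Crossing parameters strictly between `s` and `t`, in either order; hypotheses sharing a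
  -- hyperplane count once.
  let F : ℝ → ℝ → Finset ℝ := fun s t =>
    (Finset.univ.image τ).filter fun b => (s < b ∧ b < t) ∨ (t < b ∧ b < s)
  have hF : ∀ s t b, b ∈ F s t ↔ (∃ i, τ i = b) ∧ ((s < b ∧ b < t) ∨ (t < b ∧ b < s)) := by
    intro s t b; simp [F]
  -- Bisection: a point between two crossings replaces the endpoint whose vote has the same sign,
  -- which loses a crossing. A single remaining crossing means neighboring polytopes.
  have key : ∀ k, ∀ s t (hs : ∀ i, s ≠ τ i) (ht : ∀ i, t ≠ τ i), (F s t).card = k →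
      0 < vote p (Q s hs) → vote p (Q t ht) < 0 → ∃ P P' : Polytope H, Bipolar p P P' := by
    intro k
    induction k using Nat.strong_induction_on with
    | _ k ih =>
      intro s t hs ht hk hVs hVt
      by_cases h1 : (F s t).card ≤ 1
      · rcases (F s t).eq_empty_or_nonempty with h0 | ⟨b, hb⟩
        · exfalso
          have : vote p (Q s hs) = vote p (Q t ht) := by
            refine Finset.sum_congr rfl fun i _ => ?_
            by_cases hi : (Q s hs).sgn i = (Q t ht).sgn i
            · rw [hi]
            · have := (hF s t (τ i)).2 ⟨⟨i, rfl⟩, (hQ s t hs ht i).1 hi⟩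
              simp [h0] at this
          linarith
        · obtain ⟨⟨i, rfl⟩, hi⟩ := (hF s t b).1 hb
          refine ⟨Q s hs, Q t ht, ⟨i, fun j => ?_⟩, hVs, hVt⟩
          rw [hQ s t hs ht, ← hτ]
          constructor
          · intro hj
            exact Finset.card_le_one.1 h1 _ ((hF s t _).2 ⟨⟨j, rfl⟩, hj⟩) _ hb
          · intro hj
            rw [hj]; exact hi
      · obtain ⟨b, hb, b', hb', hbb⟩ : ∃ b ∈ F s t, ∃ b' ∈ F s t, b < b' := by
          obtain ⟨b, hb, b', hb', hbb⟩ := Finset.one_lt_card.1 (not_le.1 h1)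
          rcases lt_or_gt_of_ne hbb with h | h
          · exact ⟨b, hb, b', hb', h⟩
          · exact ⟨b', hb', b, hb, h⟩
        obtain ⟨u, hu, hu'⟩ := (Set.Ioo_infinite hbb).exists_notMem_finset (Finset.univ.image τ)
        have hut : ∀ i, u ≠ τ i := fun i h => hu' (by simp [h])
        have hb2 := ((hF s t b).1 hb).2
        have hb2' := ((hF s t b').1 hb').2
        obtain ⟨hu1, hu2⟩ := hu
        rcases lt_or_gt_of_ne (hzero (Q u hut)) with hV | hV
        · refine ih _ ?_ s u hs hut rfl hVs hV
          rw [← hk]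
          refine Finset.card_lt_card (Finset.ssubset_iff_of_subset ?_ |>.2 ?_)
          · intro a ha
            rw [hF] at ha ⊢
            refine ⟨ha.1, ?_⟩
            grind
          · rcases hb2 with h | h
            · exact ⟨b', hb', fun h' => by have := ((hF _ _ _).1 h').2; grind⟩
            · exact ⟨b, hb, fun h' => by have := ((hF _ _ _).1 h').2; grind⟩
        · refine ih _ ?_ u t hut ht rfl hV hVt
          rw [← hk]
          refine Finset.card_lt_card (Finset.ssubset_iff_of_subset ?_ |>.2 ?_)
          · intro a ha
            rw [hF] at ha ⊢
            refine ⟨ha.1, ?_⟩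
            grind
          · rcases hb2 with h | h
            · exact ⟨b, hb, fun h' => by have := ((hF _ _ _).1 h').2; grind⟩
            · exact ⟨b', hb', fun h' => by have := ((hF _ _ _).1 h').2; grind⟩
  -- Beyond all crossings every label at `-T` is opposite to that at `T`, so the vote changes sign.
  obtain ⟨T, hT⟩ : ∃ T, ∀ i, |τ i| < T :=
    ⟨∑ i, |τ i| + 1, fun i => lt_of_le_of_lt
      (Finset.single_le_sum (f := fun i => |τ i|) (fun j _ => abs_nonneg _) (Finset.mem_univ i))
      (lt_add_one _)⟩
  have hT1 : ∀ i, T ≠ τ i := fun i h => (h ▸ hT i).not_ge (le_abs_self _)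
  have hT2 : ∀ i, -T ≠ τ i := fun i h => by have := neg_abs_le (τ i); have := hT i; linarith
  have hneg : vote p (Q (-T) hT2) = - vote p (Q T hT1) := by
    rw [vote, vote, ← Finset.sum_neg_distrib]
    refine Finset.sum_congr rfl fun i _ => ?_
    have h1 := abs_lt.1 (hT i)
    have h2 : (Q (-T) hT2).sgn i = - (Q T hT1).sgn i := by
      change SignType.sign ((H i).eval _) = - SignType.sign ((H i).eval _)
      rw [hx, hx, sign_mul, sign_mul, sign_neg (by linarith : -T - τ i < 0),
        sign_pos (by linarith : 0 < T - τ i)]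
      simp
    rw [h2]; simp
  rcases lt_or_gt_of_ne (hzero (Q T hT1)) with hV | hV
  · exact key _ (-T) T hT2 hT1 rfl (by linarith) hV
  · exact key _ T (-T) hT1 hT2 rfl hV (by linarith)

end Teaching
-- Belief updates and comparison of the learner with the teacher
namespace Teaching

open LinSep

variable {d n : ℕ}

lemma signType_cast_eq_or {s : SignType} (hs : s ≠ 0) : (s : ℝ) = 1 ∨ (s : ℝ) = -1 := by
  rcases s with _ | _ | _
  · exact absurd rfl hs
  · right; simp
  · left; simp

lemma abs_signType_cast_le (s : SignType) : |(s : ℝ)| ≤ 1 := by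
  rcases s with _ | _ | _ <;> simp

section Update

variable {H : Fin n → LinSep d} {hs : Fin n} {w : Fin n → ℝ} {x : EuclideanSpace ℝ (Fin d)}
  {p : Fin n → ℝ}

lemma agreement_le_one (i : Fin n) : agreement H hs x i ≤ 1 :=
  (abs_le.1 (abs_signType_cast_le _)).2

lemma agreement_self (hx : (H hs).label x ≠ 0) : agreement H hs x hs = 1 := by
  rcases signType_cast_eq_or hx with h | h <;> simp [agreement, h]

lemma normalization_pos (hw : ∀ i, 0 < w i) (hp : ∀ i, 0 ≤ p i) (hps : 0 < p hs) :
    0 < ∑ j, p j * w j ^ ((1 - agreement H hs x j) / 2) :=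
  Finset.sum_pos' (fun i _ => mul_nonneg (hp i) (Real.rpow_nonneg (hw i).le _))
    ⟨hs, Finset.mem_univ _, mul_pos hps (Real.rpow_pos_of_pos (hw hs) _)⟩

lemma update_nonneg (hw : ∀ i, 0 < w i) (hp : ∀ i, 0 ≤ p i) (hps : 0 < p hs) (i : Fin n) :
    0 ≤ update H hs w x p i :=
  div_nonneg (mul_nonneg (hp i) (Real.rpow_nonneg (hw i).le _)) (normalization_pos hw hp hps).le

lemma update_target_pos (hw : ∀ i, 0 < w i) (hp : ∀ i, 0 ≤ p i) (hps : 0 < p hs) :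
    0 < update H hs w x p hs :=
  div_pos (mul_pos hps (Real.rpow_pos_of_pos (hw hs) _)) (normalization_pos hw hp hps)

lemma sum_update (hw : ∀ i, 0 < w i) (hp : ∀ i, 0 ≤ p i) (hps : 0 < p hs) :
    ∑ i, update H hs w x p i = 1 := by
  simp only [update]
  rw [← Finset.sum_div]
  exact div_self (normalization_pos hw hp hps).ne'

/-- The normalization cancels in the odds relative to the target, which is itself never penalized.
-/
lemma update_div_update_target (hw : ∀ i, 0 < w i) (hp : ∀ i, 0 ≤ p i) (hps : 0 < p hs)
    (hx : (H hs).label x ≠ 0) (i : Fin n) :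
    update H hs w x p i / update H hs w x p hs =
      p i / p hs * w i ^ ((1 - agreement H hs x i) / 2) := by
  have hN := (normalization_pos (H := H) (x := x) hw hp hps).ne'
  simp only [update]
  rw [div_div_div_cancel_right₀ hN, agreement_self hx]
  simp only [sub_self, zero_div, Real.rpow_zero, mul_one]
  ring

end Update

section Posteriors

variable {H : Fin n → LinSep d} {hs : Fin n} {p₀ : Fin n → ℝ} {wo : ℝ}
  {wl : List (EuclideanSpace ℝ (Fin d)) → Fin n → ℝ}

lemma learnerPost_isDistribution (hp_nonneg : ∀ i, 0 ≤ p₀ i) (hp_sum : ∑ i, p₀ i = 1)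
    (hp_pos : 0 < p₀ hs) (hwl : ∀ xs i, 0 < wl xs i) (xs : List (EuclideanSpace ℝ (Fin d))) :
    (∀ i, 0 ≤ learnerPost H hs p₀ wl xs i) ∧ ∑ i, learnerPost H hs p₀ wl xs i = 1 ∧
      0 < learnerPost H hs p₀ wl xs hs := by
  induction xs with
  | nil => exact ⟨hp_nonneg, hp_sum, hp_pos⟩
  | cons x xs ih =>
    exact ⟨update_nonneg (hwl _) ih.1 ih.2.2, sum_update (hwl _) ih.1 ih.2.2,
      update_target_pos (hwl _) ih.1 ih.2.2⟩

lemma teacherPost_eq_learnerPost (xs : List (EuclideanSpace ℝ (Fin d))) :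
    teacherPost H hs p₀ wo xs = learnerPost H hs p₀ (fun _ _ => wo) xs := by
  induction xs with
  | nil => rfl
  | cons x xs ih => simp only [teacherPost, learnerPost, ih]

lemma teacherPost_isDistribution (hp_nonneg : ∀ i, 0 ≤ p₀ i) (hp_sum : ∑ i, p₀ i = 1)
    (hp_pos : 0 < p₀ hs) (hwo : 0 < wo) (xs : List (EuclideanSpace ℝ (Fin d))) :
    (∀ i, 0 ≤ teacherPost H hs p₀ wo xs i) ∧ ∑ i, teacherPost H hs p₀ wo xs i = 1 ∧
      0 < teacherPost H hs p₀ wo xs hs := by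
  rw [teacherPost_eq_learnerPost]
  exact learnerPost_isDistribution hp_nonneg hp_sum hp_pos (fun _ _ => hwo) xs

/-- A learner who decreases the weights of inconsistent hypotheses more than the teacher assumes
believes in the target at least as strongly as the teacher thinks. -/
lemma teacherPost_le_learnerPost (hp_nonneg : ∀ i, 0 ≤ p₀ i) (hp_sum : ∑ i, p₀ i = 1)
    (hp_pos : 0 < p₀ hs) (hwo : 0 < wo) (hwl : ∀ xs i, 0 < wl xs i ∧ wl xs i ≤ wo)
    (xs : List (EuclideanSpace ℝ (Fin d))) (hxs : ∀ x ∈ xs, (H hs).label x ≠ 0) :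
    teacherPost H hs p₀ wo xs hs ≤ learnerPost H hs p₀ wl xs hs := by
  have hT := teacherPost_isDistribution (H := H) hp_nonneg hp_sum hp_pos hwo
  have hL := learnerPost_isDistribution (H := H) hp_nonneg hp_sum hp_pos (fun xs i => (hwl xs i).1)
  -- The normalizations differ, so odds relative to the target are compared; summed over `i` they
  -- give the inverse beliefs in the target.
  have key : ∀ i, learnerPost H hs p₀ wl xs i / learnerPost H hs p₀ wl xs hs ≤
      teacherPost H hs p₀ wo xs i / teacherPost H hs p₀ wo xs hs := by
    induction xs with
    | nil => exact fun i => le_rfl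
    | cons x xs ih =>
      intro i
      have hx := hxs x List.mem_cons_self
      simp only [learnerPost, teacherPost]
      rw [update_div_update_target (fun i => (hwl _ i).1) (hL xs).1 (hL xs).2.2 hx,
        update_div_update_target (fun _ => hwo) (hT xs).1 (hT xs).2.2 hx]
      refine mul_le_mul (ih (fun y hy => hxs y (List.mem_cons_of_mem _ hy)) i)
        (Real.rpow_le_rpow (hwl _ i).1.le (hwl _ i).2 ?_) (Real.rpow_nonneg (hwl _ i).1.le _)
        (div_nonneg ((hT xs).1 i) (hT xs).2.2.le)
      have := agreement_le_one (H := H) (hs := hs) (x := x) i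
      linarith
  have hsum := Finset.sum_le_sum fun i (_ : i ∈ Finset.univ) => key i
  rw [← Finset.sum_div, ← Finset.sum_div, (hT xs).2.1, (hL xs).2.1] at hsum
  exact (one_div_le_one_div (hL xs).2.2 (hT xs).2.2).1 hsum

end Posteriors

/-! ### Error mass of a polytope -/

section ErrorMass

variable {H : Fin n → LinSep d} {hs : Fin n} {p : Fin n → ℝ}

/-- The total weight of the hypotheses that disagree with the target on a polytope. -/
noncomputable def errorMass (p : Fin n → ℝ) (hs : Fin n) (P : Polytope H) : ℝ :=
  ∑ i, p i * ((1 - (P.sgn i : ℝ) * (P.sgn hs : ℝ)) / 2)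

lemma one_sub_eq_sum_erase [DecidableEq (Fin n)] (hsum : ∑ i, p i = 1) :
    1 - p hs = ∑ i ∈ Finset.univ.erase hs, p i := by
  rw [← hsum, Finset.sum_erase_eq_sub (Finset.mem_univ hs)]

lemma errorMass_eq (hsum : ∑ i, p i = 1) (P : Polytope H) :
    errorMass p hs P = (1 - (P.sgn hs : ℝ) * vote p P) / 2 := by
  rw [vote, Finset.mul_sum, ← hsum, ← Finset.sum_sub_distrib, Finset.sum_div]
  exact Finset.sum_congr rfl fun i _ => by ring

lemma errorMass_nonneg (hp : ∀ i, 0 ≤ p i) (P : Polytope H) : 0 ≤ errorMass p hs P := by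
  refine Finset.sum_nonneg fun i _ => mul_nonneg (hp i) ?_
  rcases signType_cast_eq_or (P.sgn_ne_zero i) with h | h <;>
    rcases signType_cast_eq_or (P.sgn_ne_zero hs) with h' | h' <;> norm_num [h, h']

/-- The target never errs. This later keeps the bounds on the odds nonnegative, so that
`ENNReal.ofReal` is additive on them. -/
lemma errorMass_le (hp : ∀ i, 0 ≤ p i) (hsum : ∑ i, p i = 1) (P : Polytope H) :
    errorMass p hs P ≤ 1 - p hs := by
  classical
  rw [one_sub_eq_sum_erase hsum, errorMass, ← Finset.add_sum_erase _ _ (Finset.mem_univ hs)]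
  have h0 : p hs * ((1 - (P.sgn hs : ℝ) * (P.sgn hs : ℝ)) / 2) = 0 := by
    rcases signType_cast_eq_or (P.sgn_ne_zero hs) with h | h <;> norm_num [h]
  rw [h0, zero_add]
  refine Finset.sum_le_sum fun i _ => mul_le_of_le_one_right (hp i) ?_
  rcases signType_cast_eq_or (P.sgn_ne_zero i) with h | h <;>
    rcases signType_cast_eq_or (P.sgn_ne_zero hs) with h' | h' <;> norm_num [h, h']

/-- One update of the teacher's belief on an example from the polytope `P`. -/
lemma inv_update_target {wo : ℝ} (hsum : ∑ i, p i = 1)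
    {P : Polytope H} {x : EuclideanSpace ℝ (Fin d)} (hx : x ∈ P.carrier) :
    (update H hs (fun _ => wo) x p hs)⁻¹ = (1 - (1 - wo) * errorMass p hs P) / p hs := by
  have hx' : ∀ i, (H i).label x = P.sgn i := hx
  have hag : ∀ i, agreement H hs x i = (P.sgn i : ℝ) * (P.sgn hs : ℝ) := fun i => by
    simp [agreement, hx']
  have hself : agreement H hs x hs = 1 := agreement_self (by rw [hx']; exact P.sgn_ne_zero hs)
  rw [update, inv_div, hself]
  simp only [sub_self, zero_div, Real.rpow_zero, mul_one]
  congr 1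
  -- Termwise: the factor is `1` on agreement, and `wo + (1 - wo) = 1` on disagreement.
  rw [errorMass, Finset.mul_sum, eq_sub_iff_add_eq, ← Finset.sum_add_distrib]
  refine (Finset.sum_congr rfl fun i _ => ?_).trans hsum
  rw [hag]
  rcases signType_cast_eq_or (P.sgn_ne_zero i) with h | h <;>
    rcases signType_cast_eq_or (P.sgn_ne_zero hs) with h' | h' <;> norm_num [h, h'] <;> ring

/-- If the target has the same sign on both polytopes, the vote opposes it on one of them, where the
error mass exceeds `1/2`. Otherwise its hyperplane is the separating one: a hypothesis with constant
sign errs on exactly one side, and one that flips is opposite to the target and errs on both. -/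
lemma Bipolar.one_sub_le_errorMass_add (h_ident : ∀ i, i ≠ hs → ∃ x, (H i).label x ≠ (H hs).label x)
    (hp : ∀ i, 0 ≤ p i) (hsum : ∑ i, p i = 1) {P P' : Polytope H} (h : Bipolar p P P') :
    (1 - p hs) / 2 ≤ errorMass p hs P + errorMass p hs P' := by
  obtain ⟨⟨i, hi⟩, hV, hV'⟩ := h
  have h0 := errorMass_nonneg (hs := hs) hp P
  have h0' := errorMass_nonneg (hs := hs) hp P'
  by_cases hsgn : P.sgn hs = P'.sgn hs
  · have hps := hp hs
    rw [errorMass_eq hsum] at h0 h0'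
    rw [← hsgn] at h0'
    rw [errorMass_eq hsum, errorMass_eq hsum, ← hsgn]
    rcases signType_cast_eq_or (P.sgn_ne_zero hs) with h | h <;> rw [h] at h0 h0' ⊢ <;> linarith
  · have hps : 1 - p hs ≤ errorMass p hs P + errorMass p hs P' := by
      classical
      rw [one_sub_eq_sum_erase hsum, errorMass, errorMass, ← Finset.sum_add_distrib,
        ← Finset.add_sum_erase _ _ (Finset.mem_univ hs)]
      have hnn : ∀ Q : Polytope H, p hs * ((1 - (Q.sgn hs : ℝ) * (Q.sgn hs : ℝ)) / 2) = 0 := by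
        intro Q
        rcases signType_cast_eq_or (Q.sgn_ne_zero hs) with h | h <;> norm_num [h]
      rw [hnn, hnn, zero_add, zero_add]
      refine Finset.sum_le_sum fun j hj => ?_
      have hj := (Finset.mem_erase.1 hj).1
      rw [← mul_add]
      refine le_mul_of_one_le_right (hp j) ?_
      have hs' : (P'.sgn hs : ℝ) = -(P.sgn hs : ℝ) := by
        have h1 := P.sgn_ne_zero hs
        have h2 := P'.sgn_ne_zero hs
        revert hsgn h1 h2
        generalize P.sgn hs = a
        generalize P'.sgn hs = b
        rcases a with _ | _ | _ <;> rcases b with _ | _ | _ <;> simp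
      by_cases hjs : P.sgn j = P'.sgn j
      · rw [hs', ← hjs]
        linarith
      · have hhyp := ((hi j).1 hjs).trans ((hi hs).1 hsgn).symm
        obtain ⟨c, hc⟩ := exists_eval_eq_mul hhyp
        have hlab : ∀ x, (H j).label x = SignType.sign c * (H hs).label x := fun x => by
          rw [label, hc, sign_mul, label]
        have hopp : ∀ Q : Polytope H, (Q.sgn j : ℝ) = -(Q.sgn hs : ℝ) := by
          intro Q
          obtain ⟨x, hx⟩ := Q.exists_point
          rw [← hx, ← hx, hlab]
          -- Identifiability excludes `c > 0`, a second copy of the target's labels.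
          rcases lt_trichotomy c 0 with h | h | h
          · simp [sign_neg h]
          · exact absurd (hlab x) (by rw [hx j, h, sign_zero, zero_mul]; exact Q.sgn_ne_zero j)
          · obtain ⟨y, hy⟩ := h_ident j hj
            exact absurd (hlab y) (by rw [sign_pos h, one_mul]; exact hy)
        rw [hopp, hopp]
        rcases signType_cast_eq_or (P.sgn_ne_zero hs) with h | h <;>
          rcases signType_cast_eq_or (P'.sgn_ne_zero hs) with h' | h' <;> norm_num [h, h']
    have := hp hs
    linarith

end ErrorMass

end Teaching
-- Expectations under a `PMF` and Markov's inequality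
open scoped ENNReal

namespace PMF

lemma tsum_mul_le_of_forall_mem_support {α : Type*} (p : PMF α) {f g : α → ℝ≥0∞}
    (h : ∀ a ∈ p.support, f a ≤ g a) : ∑' a, p a * f a ≤ ∑' a, p a * g a := by
  refine ENNReal.tsum_le_tsum fun a => ?_
  by_cases ha : p a = 0
  · simp [ha]
  · gcongr
    exact h a ha

lemma tsum_mul_le_const {α : Type*} (p : PMF α) {f : α → ℝ≥0∞} {C : ℝ≥0∞}
    (h : ∀ a ∈ p.support, f a ≤ C) : ∑' a, p a * f a ≤ C := by
  refine (p.tsum_mul_le_of_forall_mem_support h).trans ?_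
  rw [ENNReal.tsum_mul_right, p.tsum_coe, one_mul]

lemma tsum_pure_mul {α : Type*} (a : α) (f : α → ℝ≥0∞) : ∑' b, PMF.pure a b * f b = f a := by
  rw [tsum_eq_single a fun b hb => by simp [hb]]
  simp

lemma tsum_bind_mul {α β : Type*} (p : PMF α) (q : α → PMF β) (f : β → ℝ≥0∞) :
    ∑' b, p.bind q b * f b = ∑' a, p a * ∑' b, q a b * f b := by
  simp only [PMF.bind_apply, ← ENNReal.tsum_mul_right, ← ENNReal.tsum_mul_left]
  rw [ENNReal.tsum_comm]
  simp only [mul_assoc]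

/-- Markov's inequality, which is strict because the event is defined by a strict inequality. -/
lemma toOuterMeasure_mul_lt_tsum {α : Type*} (p : PMF α) {A : Set α} {f : α → ℝ≥0∞} {θ : ℝ≥0∞}
    (hθ : θ ≠ ∞) (h : ∀ a ∈ p.support, a ∈ A → θ < f a) (hA : p.toOuterMeasure A ≠ 0) :
    p.toOuterMeasure A * θ < ∑' a, p a * f a := by
  rw [Ne, PMF.toOuterMeasure_apply_eq_zero_iff, Set.not_disjoint_iff] at hA
  obtain ⟨a, hap, haA⟩ := hA
  rw [PMF.toOuterMeasure_apply, ← ENNReal.tsum_mul_right]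
  refine ENNReal.tsum_lt_tsum (i := a) ?_ (fun b => ?_) ?_
  · rw [ENNReal.tsum_mul_right]
    exact ENNReal.mul_ne_top (p.tsum_coe_indicator_ne_top A) hθ
  · by_cases hb : b ∈ A
    · rw [Set.indicator_of_mem hb]
      by_cases hbp : p b = 0
      · simp [hbp]
      · gcongr
        exact (h b hbp hb).le
    · simp [hb]
  · rw [Set.indicator_of_mem haA]
    exact (ENNReal.mul_lt_mul_iff_right hap (p.apply_ne_top a)).2 (h a hap haA)

end PMF

/-! ### Runs of the policy -/

namespace Teaching

open LinSep

variable {d n : ℕ} {H : Fin n → LinSep d} {hs : Fin n} {p₀ : Fin n → ℝ} {wo ε : ℝ}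
  {X : Finset (EuclideanSpace ℝ (Fin d))} {S : Sampling} {c : Choices H hs p₀ wo} {m : ℕ}

lemma mem_carrier_of_mem_pool {xs : List (EuclideanSpace ℝ (Fin d))} {P : Polytope H}
    {x : EuclideanSpace ℝ (Fin d)} (hx : x ∈ pool X xs P S) : x ∈ P.carrier := by
  classical
  cases S with
  | withReplacement => exact (Finset.mem_filter.1 hx).2
  | withoutReplacement => exact (Finset.mem_filter.1 (Finset.mem_filter.1 hx).1).2

/-- Fewer than `m` shown examples cannot exhaust a polytope containing `m` of them. -/
lemma Rich.pool_nonempty (hX : Rich H X m) {xs : List (EuclideanSpace ℝ (Fin d))}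
    (hxs : xs.length < m) (P : Polytope H) : (pool X xs P S).Nonempty := by
  classical
  have hP := hX P
  cases S with
  | withReplacement => exact Finset.card_pos.1 (by simp only [pool]; omega)
  | withoutReplacement =>
    by_contra h
    rw [Finset.not_nonempty_iff_eq_empty] at h
    have hsub : P.examples X ⊆ xs.toFinset := fun x hx => by
      by_contra hx'
      have : x ∈ pool X xs P .withoutReplacement :=
        Finset.mem_filter.2 ⟨hx, fun h => hx' (List.mem_toFinset.2 h)⟩
      simp [h] at this
    have h1 := Finset.card_le_card hsub
    have h2 := List.toFinset_card_le xs
    omega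

lemma mem_support_draw {xs ys : List (EuclideanSpace ℝ (Fin d))} {P : Polytope H}
    (hP : (pool X xs P S).Nonempty) (hys : ys ∈ (draw X S xs P).support) :
    ∃ x ∈ P.carrier, ys = x :: xs := by
  rw [draw, dif_pos hP, PMF.mem_support_map_iff] at hys
  obtain ⟨x, hx, rfl⟩ := hys
  exact ⟨x, mem_carrier_of_mem_pool ((PMF.mem_support_uniformOfFinset_iff hP x).1 hx), rfl⟩

lemma mem_support_step {xs ys : List (EuclideanSpace ℝ (Fin d))}
    (hpool : ∀ P : Polytope H, (pool X xs P S).Nonempty)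
    (hys : ys ∈ (step H hs p₀ wo ε X S c xs).support) :
    (1 - teacherPost H hs p₀ wo xs hs ≤ ε ∧ ys = xs) ∨
      ∃ P : Polytope H, ∃ x ∈ P.carrier, ys = x :: xs := by
  rw [step] at hys
  split_ifs at hys with h1 h2
  · rw [PMF.mem_support_bind_iff] at hys
    obtain ⟨coin, _, hys⟩ := hys
    exact Or.inr ⟨_, mem_support_draw (hpool _) hys⟩
  · exact Or.inr ⟨_, mem_support_draw (hpool _) hys⟩
  · exact Or.inl ⟨not_lt.1 h1, (PMF.mem_support_pure_iff _ _).1 hys⟩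

/-- What the policy has done after `k` rounds: it has shown at most `k` examples, all of them from
polytopes, and exactly `k` unless it has stopped. -/
lemma Rich.run_support (hX : Rich H X m) {k : ℕ} (hk : k ≤ m)
    {xs : List (EuclideanSpace ℝ (Fin d))} (hxs : xs ∈ (run H hs p₀ wo ε X S c k).support) :
    xs.length ≤ k ∧ (xs.length < k → 1 - teacherPost H hs p₀ wo xs hs ≤ ε) ∧
      ∀ x ∈ xs, (H hs).label x ≠ 0 := by
  induction k generalizing xs with
  | zero =>
    rw [run, PMF.mem_support_pure_iff] at hxs
    simp [hxs]
  | succ k ih =>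
    rw [run, PMF.mem_support_bind_iff] at hxs
    obtain ⟨ys, hys, hxs⟩ := hxs
    obtain ⟨h1, h2, h3⟩ := ih (by omega) hys
    rcases mem_support_step (fun P => hX.pool_nonempty (by omega) P) hxs with
      ⟨hdone, rfl⟩ | ⟨P, x, hx, rfl⟩
    · exact ⟨by omega, fun _ => hdone, h3⟩
    · refine ⟨by simpa using h1, fun h => ?_, fun y hy => ?_⟩
      -- Had fewer than `k` examples been shown before, the policy would have stopped and not
      -- extended the list.
      · rw [step] at hxs
        by_contra hlt
        have hdone := h2 (by simpa using h)
        rw [if_neg (not_lt.2 hdone), PMF.mem_support_pure_iff] at hxs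
        exact absurd hxs (List.cons_ne_self _ _)
      · rcases List.mem_cons.1 hy with rfl | hy
        · have hx' : ∀ i, (H i).label y = P.sgn i := hx
          rw [hx']
          exact P.sgn_ne_zero hs
        · exact h3 y hy

/-! ### Decay of the potential -/

open Classical in
/-- The teacher's odds against the target while the policy is running, and `0` once it has
stopped. -/
noncomputable def potential (H : Fin n → LinSep d) (hs : Fin n) (p₀ : Fin n → ℝ) (wo ε : ℝ)
    (xs : List (EuclideanSpace ℝ (Fin d))) : ℝ≥0∞ :=
  if ε < 1 - teacherPost H hs p₀ wo xs hs then
    ENNReal.ofReal ((teacherPost H hs p₀ wo xs hs)⁻¹ - 1) else 0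

/-- All examples of one polytope have the same effect on the teacher, so a pointwise bound suffices;
stopping only lowers the potential to `0`. -/
lemma tsum_draw_mul_potential_le (hp_nonneg : ∀ i, 0 ≤ p₀ i) (hp_sum : ∑ i, p₀ i = 1)
    (hp_pos : 0 < p₀ hs) (hwo_pos : 0 < wo) {xs : List (EuclideanSpace ℝ (Fin d))}
    {P : Polytope H} (hP : (pool X xs P S).Nonempty) :
    ∑' ys, draw X S xs P ys * potential H hs p₀ wo ε ys ≤
      ENNReal.ofReal ((1 - (1 - wo) * errorMass (teacherPost H hs p₀ wo xs) hs P) /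
        teacherPost H hs p₀ wo xs hs - 1) := by
  refine PMF.tsum_mul_le_const _ fun ys hys => ?_
  obtain ⟨x, hx, rfl⟩ := mem_support_draw hP hys
  rw [← inv_update_target (teacherPost_isDistribution hp_nonneg hp_sum hp_pos hwo_pos xs).2.1 hx,
    potential]
  split_ifs
  · rfl
  · exact zero_le

/-- One round of the policy decreases the expected potential by the factor `1 - (1 - wo) / 4`. -/
lemma tsum_step_mul_potential_le
    (h_ident : ∀ i, i ≠ hs → ∃ x, (H i).label x ≠ (H hs).label x)
    (hp_nonneg : ∀ i, 0 ≤ p₀ i) (hp_sum : ∑ i, p₀ i = 1)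
    (hp_pos : 0 < p₀ hs) (hwo_pos : 0 < wo) (hwo : wo < 1)
    {xs : List (EuclideanSpace ℝ (Fin d))}
    (hpool : ∀ P : Polytope H, (pool X xs P S).Nonempty) :
    ∑' ys, step H hs p₀ wo ε X S c xs ys * potential H hs p₀ wo ε ys ≤
      ENNReal.ofReal (1 - (1 - wo) / 4) * potential H hs p₀ wo ε xs := by
  have hdraw := fun P : Polytope H =>
    tsum_draw_mul_potential_le (ε := ε) hp_nonneg hp_sum hp_pos hwo_pos (hpool P)
  obtain ⟨hp, hsum, hps⟩ := teacherPost_isDistribution (H := H) hp_nonneg hp_sum hp_pos hwo_pos xs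
  rw [step]
  set p := teacherPost H hs p₀ wo xs with hp_def
  have hps1 : p hs ≤ 1 := hsum ▸ Finset.single_le_sum (fun i _ => hp i) (Finset.mem_univ hs)
  have hr : 0 ≤ 1 - (1 - wo) / 4 := by linarith
  by_cases hrun : ε < 1 - p hs
  swap
  · rw [if_neg hrun, PMF.tsum_pure_mul, potential, if_neg hrun]
    simp
  rw [if_pos hrun, potential, if_pos hrun, ← ENNReal.ofReal_mul hr, ← hp_def]
  -- At `D = (1 - p hs) / 4` this is an equality, and the left side decreases in `D`.
  have htarget : ∀ D, (1 - p hs) / 4 ≤ D → (1 - (1 - wo) * D) / p hs - 1 ≤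
      (1 - (1 - wo) / 4) * ((p hs)⁻¹ - 1) := by
    intro D hD
    have h1 : (1 - wo) * ((1 - p hs) / 4) ≤ (1 - wo) * D :=
      mul_le_mul_of_nonneg_left hD (by linarith)
    have h2 : (1 - (1 - wo) * D) / p hs ≤ (1 - (1 - wo) * ((1 - p hs) / 4)) / p hs := by
      gcongr
    refine (sub_le_sub_right h2 1).trans (le_of_eq ?_)
    field_simp
    ring
  split_ifs with hbip
  · have hnonneg : ∀ P : Polytope H, 0 ≤ (1 - (1 - wo) * errorMass p hs P) / p hs - 1 := by
      intro P
      rw [sub_nonneg, one_le_div hps]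
      have h1 := errorMass_le (hs := hs) hp hsum P
      have h2 := errorMass_nonneg (hs := hs) hp P
      nlinarith
    rw [PMF.tsum_bind_mul, tsum_fintype, Fintype.sum_bool]
    simp only [PMF.uniformOfFintype_apply, Fintype.card_bool, Nat.cast_ofNat, if_true,
      Bool.false_eq_true, if_false]
    refine (add_le_add (mul_le_mul_right (hdraw _) _) (mul_le_mul_right (hdraw _) _)).trans ?_
    have h2 : (2 : ℝ≥0∞)⁻¹ = ENNReal.ofReal 2⁻¹ := by
      rw [ENNReal.ofReal_inv_of_pos two_pos]; simp
    rw [h2, ← ENNReal.ofReal_mul (by norm_num), ← ENNReal.ofReal_mul (by norm_num),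
      ← ENNReal.ofReal_add (mul_nonneg (by norm_num) (hnonneg _))
        (mul_nonneg (by norm_num) (hnonneg _))]
    refine ENNReal.ofReal_le_ofReal ?_
    have hb := (c.bipolar xs hbip).one_sub_le_errorMass_add h_ident hp hsum
    refine le_trans (le_of_eq ?_) (htarget
      ((errorMass p hs (c.fst xs) + errorMass p hs (c.snd xs)) / 2) (by linarith))
    ring
  · refine (hdraw _).trans (ENNReal.ofReal_le_ofReal (htarget _ ?_))
    -- The minimizer then has vote zero, hence error mass `1/2`.
    obtain ⟨Q, hQ⟩ := (exists_bipolar_or_vote_eq_zero H p).resolve_left hbip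
    have h0 := c.argmin_le xs Q
    rw [← hp_def, hQ, abs_zero] at h0
    rw [errorMass_eq hsum, abs_nonpos_iff.1 h0]
    linarith

lemma Rich.tsum_run_mul_potential_le (hX : Rich H X m)
    (h_ident : ∀ i, i ≠ hs → ∃ x, (H i).label x ≠ (H hs).label x)
    (hp_nonneg : ∀ i, 0 ≤ p₀ i) (hp_sum : ∑ i, p₀ i = 1)
    (hp_pos : 0 < p₀ hs) (hwo_pos : 0 < wo) (hwo : wo < 1) {k : ℕ} (hk : k ≤ m) :
    ∑' xs, run H hs p₀ wo ε X S c k xs * potential H hs p₀ wo ε xs ≤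
      ENNReal.ofReal (1 - (1 - wo) / 4) ^ k * ENNReal.ofReal ((p₀ hs)⁻¹ - 1) := by
  induction k with
  | zero =>
    rw [run, PMF.tsum_pure_mul, potential, pow_zero, one_mul]
    split_ifs
    · rfl
    · exact zero_le
  | succ k ih =>
    rw [run, PMF.tsum_bind_mul]
    refine (PMF.tsum_mul_le_of_forall_mem_support _ fun xs hxs =>
      tsum_step_mul_potential_le h_ident hp_nonneg hp_sum hp_pos hwo_pos hwo fun P =>
        hX.pool_nonempty ?_ P).trans ?_
    · have := (hX.run_support (by omega) hxs).1
      omega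
    · simp only [mul_left_comm _ (ENNReal.ofReal (1 - (1 - wo) / 4))]
      rw [ENNReal.tsum_mul_left, pow_succ', mul_assoc]
      gcongr
      exact ih (by omega)

/-- If the learner fails, the teacher's belief in the target is below `1 - ε`; the policy is then
still running and the potential exceeds `ε / (1 - ε)`, the threshold for Markov's inequality. -/
lemma Rich.failureProb_lt (hX : Rich H X m)
    (h_ident : ∀ i, i ≠ hs → ∃ x, (H i).label x ≠ (H hs).label x)
    (hp_nonneg : ∀ i, 0 ≤ p₀ i) (hp_sum : ∑ i, p₀ i = 1)
    (hp_pos : 0 < p₀ hs) (hp_lt : p₀ hs < 1) (hwo : wo < 1)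
    {wl : List (EuclideanSpace ℝ (Fin d)) → Fin n → ℝ}
    (hwl : ∀ xs i, 0 < wl xs i ∧ wl xs i ≤ wo) (hε_pos : 0 < ε) (hε_lt : ε < 1) :
    failureProb H hs p₀ wo ε X S c wl m
      < (1 - ε) * (1 - p₀ hs) / (ε * p₀ hs) * Real.exp (-(m * (1 - wo) / 4)) := by
  have hwo_pos : 0 < wo := (hwl [] hs).1.trans_le (hwl [] hs).2
  have h1ε : 0 < 1 - ε := by linarith
  have h1p : 0 < 1 - p₀ hs := by linarith
  rw [failureProb]
  set A := {xs | 1 - learnerPost H hs p₀ wl xs hs > ε} with hA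
  set q := (run H hs p₀ wo ε X S c m).toOuterMeasure A with hq
  -- The strict Markov inequality needs an event of positive probability; otherwise positivity of
  -- the bound suffices.
  by_cases hq0 : q = 0
  · rw [hq0, ENNReal.toReal_zero]
    positivity
  have hmarkov : q * ENNReal.ofReal (ε / (1 - ε)) <
      ENNReal.ofReal (1 - (1 - wo) / 4) ^ m * ENNReal.ofReal ((p₀ hs)⁻¹ - 1) := by
    refine (PMF.toOuterMeasure_mul_lt_tsum _ ENNReal.ofReal_ne_top (fun xs hxs hxA => ?_) hq0).trans_le
      (hX.tsum_run_mul_potential_le (ε := ε) (S := S) (c := c) h_ident hp_nonneg hp_sum hp_pos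
        hwo_pos hwo le_rfl)
    have hle := teacherPost_le_learnerPost hp_nonneg hp_sum hp_pos hwo_pos hwl xs
      (hX.run_support le_rfl hxs).2.2
    have hpos := (teacherPost_isDistribution (H := H) hp_nonneg hp_sum hp_pos hwo_pos xs).2.2
    have hfail : ε < 1 - learnerPost H hs p₀ wl xs hs := hxA
    have hlt : teacherPost H hs p₀ wo xs hs < 1 - ε := by linarith
    rw [potential, if_pos (by linarith)]
    have hinv : (1 - ε)⁻¹ < (teacherPost H hs p₀ wo xs hs)⁻¹ :=
      (inv_lt_inv₀ h1ε hpos).2 hlt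
    have heq : ε / (1 - ε) = (1 - ε)⁻¹ - 1 := by field_simp; ring
    refine (ENNReal.ofReal_lt_ofReal_iff_of_nonneg (by positivity)).2 ?_
    linarith
  have hr : 0 ≤ 1 - (1 - wo) / 4 := by linarith
  have hodds : 0 < (p₀ hs)⁻¹ - 1 := sub_pos.2 ((one_lt_inv₀ hp_pos).2 hp_lt)
  have hreal : q.toReal * (ε / (1 - ε)) < (1 - (1 - wo) / 4) ^ m * ((p₀ hs)⁻¹ - 1) := by
    have := (ENNReal.toReal_lt_toReal hmarkov.ne_top
      (ENNReal.mul_ne_top (ENNReal.pow_ne_top ENNReal.ofReal_ne_top) ENNReal.ofReal_ne_top)).2 hmarkov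
    rwa [ENNReal.toReal_mul, ENNReal.toReal_mul, ENNReal.toReal_pow, ENNReal.toReal_ofReal hr,
      ENNReal.toReal_ofReal hodds.le, ENNReal.toReal_ofReal (by positivity)] at this
  have hexp : (1 - (1 - wo) / 4) ^ m ≤ Real.exp (-(m * (1 - wo) / 4)) := by
    have h1 : 1 - (1 - wo) / 4 ≤ Real.exp (-((1 - wo) / 4)) := by
      have := Real.add_one_le_exp (-((1 - wo) / 4))
      linarith
    refine (pow_le_pow_left₀ hr h1 m).trans (le_of_eq ?_)
    rw [← Real.exp_nat_mul]
    congr 1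
    ring
  have hfinal := hreal.trans_le (mul_le_mul_of_nonneg_right hexp hodds.le)
  rw [← mul_div_assoc, div_lt_iff₀ h1ε, ← lt_div_iff₀ hε_pos] at hfinal
  refine hfinal.trans_le (le_of_eq ?_)
  field_simp

end Teaching

/-! ### The main theorem -/

theorem theorem3 {d n : ℕ} (H : Fin n → LinSep d) (hs : Fin n)
    (h_ident : ∀ i, i ≠ hs → ∃ x, (H i).label x ≠ (H hs).label x)
    (X : Finset (EuclideanSpace ℝ (Fin d)))
    (p₀ : Fin n → ℝ) (hp_nonneg : ∀ i, 0 ≤ p₀ i) (hp_sum : ∑ i, p₀ i = 1)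
    (hp_pos : 0 < p₀ hs) (hp_lt : p₀ hs < 1)
    (wo : ℝ) (hwo : wo < 1)
    (wl : List (EuclideanSpace ℝ (Fin d)) → Fin n → ℝ)
    (hwl : ∀ xs i, 0 < wl xs i ∧ wl xs i ≤ wo)
    (ε : ℝ) (hε_pos : 0 < ε) (hε_lt : ε < 1)
    (S : Teaching.Sampling) (c : Teaching.Choices H hs p₀ wo)
    (m : ℕ) (hX : Teaching.Rich H X m) :
    (∀ xs ∈ (Teaching.run H hs p₀ wo ε X S c m).support,
      xs.length ≤ m ∧
        (xs.length < m → 1 - Teaching.teacherPost H hs p₀ wo xs hs ≤ ε)) ∧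
    Teaching.failureProb H hs p₀ wo ε X S c wl m
      < (1 - ε) * (1 - p₀ hs) / (ε * p₀ hs) * Real.exp (-(m * (1 - wo) / 4)) ∧
    ∀ δ : ℝ, 0 < δ →
      4 / (1 - wo) * Real.log ((1 - ε) * (1 - p₀ hs) / (δ * ε * p₀ hs)) ≤ m →
      Teaching.failureProb H hs p₀ wo ε X S c wl m < δ := by
  have hlt := hX.failureProb_lt (S := S) (c := c) h_ident hp_nonneg hp_sum hp_pos hp_lt hwo hwl
    hε_pos hε_lt
  refine ⟨fun xs hxs => ⟨(hX.run_support le_rfl hxs).1, (hX.run_support le_rfl hxs).2.1⟩, hlt,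
    fun δ hδ hm => hlt.trans_le ?_⟩
  have h1ε : 0 < 1 - ε := by linarith
  have h1p : 0 < 1 - p₀ hs := by linarith
  have h1w : 0 < 1 - wo := by linarith
  have hlog : Real.log ((1 - ε) * (1 - p₀ hs) / (δ * ε * p₀ hs)) ≤ m * (1 - wo) / 4 := by
    rw [div_mul_eq_mul_div, div_le_iff₀ h1w] at hm
    linarith
  rw [Real.log_le_iff_le_exp (by positivity), div_le_iff₀ (by positivity)] at hlog
  rw [Real.exp_neg, ← div_eq_mul_inv, div_le_iff₀ (Real.exp_pos _), div_le_iff₀ (by positivity)]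
  linarith
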